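/- Let $\mathcal A$ be an algebra of difference functions in one generator $u$ on the lattice $\mathbb Z^2$: a commutative $\mathbb C$-algebra with two commuting automorphisms $\mathcal S_1,\mathcal S_2$, elements $u_N$ ($N\in\mathbb Z^2$, $u=u_{(0,0)}$) and commuting $\mathbb C$-linear derivations $\partial/\partial u_N$ such that $\mathcal S_i u_N=u_{N+E_i}$, $\partial u_N/\partial u_M=\delta_{MN}$, each $f\in\mathcal A$ has only finitely many nonzero derivatives $\partial f/\partial u_N$, and $\frac{\partial}{\partial u_M}\mathcal S_i f=\mathcal S_i\frac{\partial f}{\partial u_{M-E_i}}$, where $E_1=(1,0)$ and $E_2=(0,1)$. Assume that $\mathcal A$ is an integral domain and that the only elements of its field of fractions with all partial derivatives zero are the complex numbers. Write $\mathcal S^N=\mathcal S_1^{n_1}\mathcal S_2^{n_2}$ and $\lambda^N=\lambda_1^{n_1}\lambda_2^{n_2}$ for $N=(n_1,n_2)$. A difference operator $P=\sum_L P_L\mathcal S^L$ (a finite sum over $L\in\mathbb Z^2$, $P_L\in\mathcal A$) defines the $\lambda$-bracket $\mathcal A\times\mathcal A\to\mathcal A[\lambda_1^{\pm1},\lambda_2^{\pm1}]$,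 $$\{f_\lambda g\}=\sum_{M,N\in\mathbb Z^2}\frac{\partial g}{\partial u_N}(\lambda\mathcal S)^N P(\lambda\mathcal S)(\lambda\mathcal S)^{-M}\frac{\partial f}{\partial u_M}.$$ $P$ is called Hamiltonian if this bracket makes $\mathcal A$ a multiplicative Poisson vertex algebra, that is, if it is $\mathbb C$-bilinear, sesquilinear ($\{\mathcal S_if_\lambda g\}=\lambda_i^{-1}\{f_\lambda g\}$, $\{f_\lambda\mathcal S_ig\}=\lambda_i\mathcal S_i\{f_\lambda g\}$), obeys the Leibniz rules ($\{f_\lambda gh\}=\{f_\lambda g\}h+\{f_\lambda h\}g$, $\{fg_\lambda h\}=\{f_{\lambda\mathcal S}h\}g+\{g_{\lambda\mathcal S}h\}f$), is skewsymmetric ($\{g_\lambda f\}=-\sum_I(\lambda\mathcal S)^{-I}a_I$ if $\{f_\lambda g\}=\sum_I a_I\lambda^I$) and satisfies the Jacobi identity $\{f_\lambda\{g_\mu h\}\}-\{g_\mu\{f_\lambda h\}\}=\{\{f_\lambda g\}_{\lambda\mu}h\}$. Two Hamiltonian operators $P$, $Q$ are compatible, or form a bi-Hamiltonian pair, if $P+\eta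 Q$ is Hamiltonian for every $\eta\in\mathbb C$. Let $f_1,f_2\in\mathcal A$ be functions of $u$ alone ($\partial f_j/\partial u_N=0$ for $N\neq(0,0)$), let $\alpha_j,\beta_j,\gamma_j,\delta_j,\epsilon_j\in\mathbb C$ for $j=1,2$, and let $$P_j=f_j\circ\bigl(\alpha_j\mathcal S_1^2+\beta_j\mathcal S_1\mathcal S_2+\gamma_j\mathcal S_2^2+\delta_j\mathcal S_1+\epsilon_j\mathcal S_2-\alpha_j\mathcal S_1^{-2}-\beta_j\mathcal S_1^{-1}\mathcal S_2^{-1}-\gamma_j\mathcal S_2^{-2}-\delta_j\mathcal S_1^{-1}-\epsilon_j\mathcal S_2^{-1}\bigr)\circ f_j .$$ Assume $P_1\neq0$ and $P_2\neq0$. Then $P_1$ and $P_2$ are Hamiltonian and compatible if and only if $f_2=\kappa f_1$ for some $\kappa\in\mathbb C$, $\kappa\neq0$. -/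

import Mathlib

/-- An algebra of difference functions in one generator `u` on the lattice `ℤ²`, over `ℂ`: a
commutative `ℂ`-algebra with two commuting automorphisms `S₁`, `S₂`, lattice variables `u_N`
(`N ∈ ℤ²`) and commuting partial derivations `pd N = ∂/∂u_N`; each element has only finitely many
nonzero partial derivatives, and `∂_M ∘ S_i = S_i ∘ ∂_{M - E_i}`. (If `A` is nontrivial, then
`pd_u` makes the `u_N` algebraically independent over `ℂ`, so that `A` is an extension of the
algebra of difference polynomials `ℂ[u_N]`.) -/
class DifferenceFunctionAlgebra (A : Type*) [CommRing A] [Algebra ℂ A] where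
  S₁ : A ≃ₐ[ℂ] A
  S₂ : A ≃ₐ[ℂ] A
  S_comm : ∀ f : A, S₁ (S₂ f) = S₂ (S₁ f)
  u : ℤ × ℤ → A
  S₁_u : ∀ N : ℤ × ℤ, S₁ (u N) = u (N + (1, 0))
  S₂_u : ∀ N : ℤ × ℤ, S₂ (u N) = u (N + (0, 1))
  pd : ℤ × ℤ → Derivation ℂ A A
  pd_u : ∀ M N : ℤ × ℤ, pd M (u N) = if M = N then 1 else 0
  pd_comm : ∀ (M N : ℤ × ℤ) (f : A), pd M (pd N f) = pd N (pd M f)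
  finite_pd : ∀ f : A, {N : ℤ × ℤ | pd N f ≠ 0}.Finite
  pd_S₁ : ∀ (M : ℤ × ℤ) (f : A), pd M (S₁ f) = S₁ (pd (M - (1, 0)) f)
  pd_S₂ : ∀ (M : ℤ × ℤ) (f : A), pd M (S₂ f) = S₂ (pd (M - (0, 1)) f)

namespace DifferenceFunctionAlgebra

variable {A : Type*} [CommRing A] [Algebra ℂ A] [DifferenceFunctionAlgebra A]

/-- The shift `S^N = S₁^{n₁} S₂^{n₂}`. -/
noncomputable def shift (N : ℤ × ℤ) : A ≃ₐ[ℂ] A := S₁ ^ N.1 * S₂ ^ N.2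

/-- The finite set of multi-indices `N` with `∂f/∂u_N ≠ 0`. -/
noncomputable def vars (f : A) : Finset (ℤ × ℤ) := (finite_pd f).toFinset

/-- `f = f(u)`: the element `f` depends on no lattice variable other than `u = u_{(0,0)}`. -/
def IsFunctionOfU (f : A) : Prop := ∀ N : ℤ × ℤ, N ≠ 0 → pd N f = 0

variable (A) in
/-- The only constants of the field of fractions of `A` are the complex numbers: if all partial
derivatives of a quotient `a / b` vanish, that is `b ∂_N a - a ∂_N b = 0` for every `N`, then
`a / b` is a complex number. -/
def OnlyComplexConstants : Prop :=
  ∀ a b : A, b ≠ 0 → (∀ N : ℤ × ℤ, b * pd N a = a * pd N b) → ∃ c : ℂ, a = c • b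

/-! ### Scalar difference operators

A local scalar difference operator `P = ∑_L P_L S^L` is its finitely supported family of
coefficients `P_L`, an element of `(ℤ × ℤ) →₀ A`. -/

/-- The operator `a S^L`. -/
noncomputable def monomialOp (L : ℤ × ℤ) (a : A) : (ℤ × ℤ) →₀ A := Finsupp.single L a

/-- The product of difference operators, determined by `(a S^K) ∘ (b S^L) = a S^K(b) S^{K+L}`. -/
noncomputable def compOp (P Q : (ℤ × ℤ) →₀ A) : (ℤ × ℤ) →₀ A :=
  P.sum fun K a => Q.sum fun L b => monomialOp (K + L) (a * shift K b)

/-- The constant coefficient operator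
`α S₁² + β S₁S₂ + γ S₂² + δ S₁ + ε S₂ - (S_i ↔ S_i⁻¹)`. -/
noncomputable def constantOp (α β γ δ ε : ℂ) : (ℤ × ℤ) →₀ A :=
  (monomialOp (2, 0) (algebraMap ℂ A α) + monomialOp (1, 1) (algebraMap ℂ A β)
    + monomialOp (0, 2) (algebraMap ℂ A γ) + monomialOp (1, 0) (algebraMap ℂ A δ)
    + monomialOp (0, 1) (algebraMap ℂ A ε))
  - (monomialOp (-2, 0) (algebraMap ℂ A α) + monomialOp (-1, -1) (algebraMap ℂ A β)
    + monomialOp (0, -2) (algebraMap ℂ A γ) + monomialOp (-1, 0) (algebraMap ℂ A δ)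
    + monomialOp (0, -1) (algebraMap ℂ A ε))

/-- The operator of general form
`f ∘ (α S₁² + β S₁S₂ + γ S₂² + δ S₁ + ε S₂ - (S_i ↔ S_i⁻¹)) ∘ f`. -/
noncomputable def generalOp (f : A) (α β γ δ ε : ℂ) : (ℤ × ℤ) →₀ A :=
  compOp (monomialOp 0 f) (compOp (constantOp α β γ δ ε) (monomialOp 0 f))

/-! ### Multiplicative Poisson vertex algebras

An element `∑_I a_I λ^I` of `ℂ[λ₁^{±1}, λ₂^{±1}] ⊗ A` is its finitely supported family of
coefficients `a_I ∈ A`. So `br f g I` is the coefficient of `λ^I` in `{f_λ g}`. -/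

/-- `br` is a local multiplicative Poisson vertex algebra structure of rank 2 on `A`. -/
structure IsMultiplicativePVA (br : A → A → ((ℤ × ℤ) →₀ A)) : Prop where
  add_left : ∀ f g h : A, br (f + g) h = br f h + br g h
  add_right : ∀ f g h : A, br f (g + h) = br f g + br f h
  smul_left : ∀ (c : ℂ) (f g : A), br (c • f) g = c • br f g
  smul_right : ∀ (c : ℂ) (f g : A), br f (c • g) = c • br f g
  /-- `{S₁f_λ g} = λ₁⁻¹ {f_λ g}` -/
  sesqui_left₁ : ∀ (f g : A) (I : ℤ × ℤ), br (S₁ f) g I = br f g (I + (1, 0))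
  /-- `{S₂f_λ g} = λ₂⁻¹ {f_λ g}` -/
  sesqui_left₂ : ∀ (f g : A) (I : ℤ × ℤ), br (S₂ f) g I = br f g (I + (0, 1))
  /-- `{f_λ S₁g} = λ₁ S₁{f_λ g}` -/
  sesqui_right₁ : ∀ (f g : A) (I : ℤ × ℤ), br f (S₁ g) I = S₁ (br f g (I - (1, 0)))
  /-- `{f_λ S₂g} = λ₂ S₂{f_λ g}` -/
  sesqui_right₂ : ∀ (f g : A) (I : ℤ × ℤ), br f (S₂ g) I = S₂ (br f g (I - (0, 1)))
  /-- `{f_λ gh} = {f_λ g} h + {f_λ h} g` -/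
  leibniz_right : ∀ (f g h : A) (I : ℤ × ℤ), br f (g * h) I = br f g I * h + br f h I * g
  /-- `{fg_λ h} = {f_{λS} h} g + {g_{λS} h} f`, the shifts acting on the right -/
  leibniz_left : ∀ (f g h : A) (I : ℤ × ℤ),
    br (f * g) h I = br f h I * shift I g + br g h I * shift I f
  /-- `{g_λ f} = - ∑_I (λS)^{-I} a_I`, where `{f_λ g} = ∑_I a_I λ^I` -/
  skew : ∀ (f g : A) (I : ℤ × ℤ), br g f I = - shift I (br f g (-I))
  /-- The coefficient of `λ^K μ^I` in
  `{f_λ {g_μ h}} - {g_μ {f_λ h}} = {{f_λ g}_{λμ} h}`; on the right, it comes from the terms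
  `λ^{K-I} (λμ)^I`. -/
  jacobi : ∀ (f g h : A) (K I : ℤ × ℤ),
    br f (br g h I) K - br g (br f h K) I = br (br f g (K - I)) h I

/-- The `λ`-bracket of the difference operator `P = ∑_L P_L S^L`, that is the one with
`{u_λ u} = ∑_L P_L λ^L`, extended to `A` by the master formula
`{f_λ g} = ∑_{M,N} (∂g/∂u_N) (λS)^N P(λS) (λS)^{-M} (∂f/∂u_M)`. -/
noncomputable def lambdaBracket (P : (ℤ × ℤ) →₀ A) (f g : A) : (ℤ × ℤ) →₀ A :=
  ∑ N ∈ vars g, ∑ M ∈ vars f, P.sum fun L a =>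
    Finsupp.single (N + L - M) (pd N g * shift N (a * shift (L - M) (pd M f)))

/-- `P` is a Hamiltonian operator: its `λ`-bracket is a multiplicative Poisson vertex algebra
structure. -/
def IsHamiltonian (P : (ℤ × ℤ) →₀ A) : Prop := IsMultiplicativePVA (lambdaBracket P)

/-- `P` and `Q` are compatible Hamiltonian operators (a bi-Hamiltonian pair): both are Hamiltonian
and so is `P + η Q` for every constant `η`. -/
def IsBiHamiltonianPair (P Q : (ℤ × ℤ) →₀ A) : Prop :=
  IsHamiltonian P ∧ IsHamiltonian Q ∧ ∀ η : ℂ, IsHamiltonian (P + η • Q)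

end DifferenceFunctionAlgebra

namespace DifferenceFunctionAlgebra

variable {A : Type*} [CommRing A] [Algebra ℂ A] [DifferenceFunctionAlgebra A]

/-! ### Shifts and partial derivatives -/

/-! Sufficiency. If φ depends on u alone, the derivations D_N = S^N(φ) ∂_N commute, as if in a
coordinate v with dv = du/φ. In this frame the bracket of φ ∘ (∑ c_L S^L) ∘ φ has the constant
coefficients c, so it satisfies Jacobi as soon as c is odd (`conjBracket_jacobi`). For f₂ = κf₁
every P₁ + ηP₂ is again of this form, with φ = f₁ and coefficients c + ηκ²d, where c and d are the
coefficients of the two constant operators.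

Necessity. Write f = f₁, g = f₂ and let R = P₁ + P₂ be Hamiltonian. Where R_{K-I} = R_{I-K} = 0,
Jacobi on u reduces to ∂₀(R_I) R_K = ∂₀(R_K) R_I (`IsHamiltonian.pd_mul_eq`). Take K = b and I = -a,
with a, b the lexicographically largest exponents of c and d; a + b lies beyond both supports. The
relation then factors as the Wronskian f g' - g f' times a bilinear expression in shifts of f and g.
Either factor vanishing forces the Wronskian to vanish (`wronskian_eq_zero`), so g/f is a constant,
hence a complex number. -/

theorem shift_zero (f : A) : shift 0 f = f := by simp [shift]

theorem shift_add (M N : ℤ × ℤ) (f : A) : shift (M + N) f = shift M (shift N f) := by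
  have hc : Commute (S₁ : A ≃ₐ[ℂ] A) S₂ := AlgEquiv.ext fun f => S_comm f
  have h : (shift (M + N) : A ≃ₐ[ℂ] A) = shift M * shift N := by
    unfold shift
    have h1 := (hc.zpow_zpow N.1 M.2).eq
    rw [Prod.fst_add, Prod.snd_add, zpow_add, zpow_add, mul_assoc, mul_assoc,
      ← mul_assoc (S₁ ^ N.1), h1, mul_assoc]
  rw [h]; rfl

theorem shift_fst (f : A) : shift (1, 0) f = S₁ f := by simp [shift]

theorem shift_snd (f : A) : shift (0, 1) f = S₂ f := by simp [shift]

theorem pd_zpow (S : A ≃ₐ[ℂ] A) (e : ℤ × ℤ)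
    (h : ∀ (M : ℤ × ℤ) (f : A), pd M (S f) = S (pd (M - e) f)) (n : ℤ) :
    ∀ (M : ℤ × ℤ) (f : A), pd M ((S ^ n) f) = (S ^ n) (pd (M - n • e) f) := by
  have hinv : ∀ (M : ℤ × ℤ) (f : A), pd M (S⁻¹ f) = S⁻¹ (pd (M + e) f) := by
    intro M f
    apply S.injective
    have h1 : ∀ x : A, S (S⁻¹ x) = x := fun x => S.apply_symm_apply x
    have h2 := h (M + e) (S⁻¹ f)
    rw [h1, add_sub_cancel_right] at h2
    rw [h1, h2]
  induction n using Int.induction_on with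
  | zero => intro M f; simp
  | succ n ih =>
    intro M f
    rw [zpow_add_one, AlgEquiv.mul_apply, ih, h, AlgEquiv.mul_apply, add_smul, one_smul, sub_sub]
  | pred n ih =>
    intro M f
    rw [zpow_sub_one, AlgEquiv.mul_apply, ih, hinv, AlgEquiv.mul_apply, sub_smul, one_smul,
      sub_sub_eq_add_sub, sub_add_eq_add_sub]

theorem pd_shift (M N : ℤ × ℤ) (f : A) : pd M (shift N f) = shift N (pd (M - N) f) := by
  unfold shift
  rw [AlgEquiv.mul_apply, pd_zpow S₁ (1, 0) pd_S₁, pd_zpow S₂ (0, 1) pd_S₂, AlgEquiv.mul_apply,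
    sub_sub]
  congr 4
  ext <;> simp

theorem pd_eq_zero_of_notMem_vars {f : A} {N : ℤ × ℤ} (h : N ∉ vars f) : pd N f = 0 := by
  simpa [vars] using h

theorem IsFunctionOfU.pd_shift_of_ne {φ : A} (hφ : IsFunctionOfU φ) {M N : ℤ × ℤ} (h : M ≠ N) :
    pd M (shift N φ) = 0 := by
  rw [pd_shift, hφ _ (sub_ne_zero.2 h), map_zero]

theorem pd_shift_self (N : ℤ × ℤ) (φ : A) : pd N (shift N φ) = shift N (pd 0 φ) := by
  rw [pd_shift, sub_self]

/-! ### Twisted partial derivatives and evolutionary derivations -/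

/-- The derivation `S^N(φ) ∂/∂u_N`. -/
noncomputable def twistedPd (φ : A) (N : ℤ × ℤ) : Derivation ℂ A A := shift N φ • pd N

theorem twistedPd_apply (φ : A) (N : ℤ × ℤ) (f : A) :
    twistedPd φ N f = shift N φ * pd N f := rfl

theorem twistedPd_eq_zero (φ : A) {f : A} {N : ℤ × ℤ} (h : N ∉ vars f) :
    twistedPd φ N f = 0 := by
  rw [twistedPd_apply, pd_eq_zero_of_notMem_vars h, mul_zero]

theorem twistedPd_shift (φ : A) (M N : ℤ × ℤ) (f : A) :
    twistedPd φ M (shift N f) = shift N (twistedPd φ (M - N) f) := by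
  rw [twistedPd_apply, twistedPd_apply, pd_shift, map_mul, ← shift_add, add_sub_cancel]

/-- The cross terms D_M(S^N φ) vanish for M ≠ N because φ involves only u. All later commutation
rests on this. -/
theorem twistedPd_comm {φ : A} (hφ : IsFunctionOfU φ) (M N : ℤ × ℤ) (f : A) :
    twistedPd φ M (twistedPd φ N f) = twistedPd φ N (twistedPd φ M f) := by
  rcases eq_or_ne M N with rfl | h
  · rfl
  · simp only [twistedPd_apply, Derivation.leibniz, smul_eq_mul, hφ.pd_shift_of_ne h,
      hφ.pd_shift_of_ne h.symm, pd_comm M N]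
    ring

/-- The value at `g` of the derivation `∑_N F_N S^N(φ) ∂/∂u_N`. -/
noncomputable def evol (φ : A) (F : ℤ × ℤ → A) (g : A) : A :=
  ∑ᶠ N, F N * twistedPd φ N g

theorem evol_eq_sum (φ : A) (F : ℤ × ℤ → A) {g : A} {T : Finset (ℤ × ℤ)}
    (h : ∀ N, N ∉ T → twistedPd φ N g = 0) : evol φ F g = ∑ N ∈ T, F N * twistedPd φ N g := by
  apply finsum_eq_sum_of_support_subset
  intro N hN
  by_contra hT
  exact hN (by simp only [h N hT, mul_zero])

theorem evol_eq_sum_vars (φ : A) (F : ℤ × ℤ → A) (g : A) :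
    evol φ F g = ∑ N ∈ vars g, F N * twistedPd φ N g :=
  evol_eq_sum φ F fun _ h => twistedPd_eq_zero φ h

theorem evol_add (φ : A) (F : ℤ × ℤ → A) (f g : A) :
    evol φ F (f + g) = evol φ F f + evol φ F g := by
  classical
  have hf : ∀ N, N ∉ vars f ∪ vars g → twistedPd φ N f = 0 := fun N h =>
    twistedPd_eq_zero φ fun h' => h (Finset.mem_union_left _ h')
  have hg : ∀ N, N ∉ vars f ∪ vars g → twistedPd φ N g = 0 := fun N h =>
    twistedPd_eq_zero φ fun h' => h (Finset.mem_union_right _ h')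
  rw [evol_eq_sum φ F hf, evol_eq_sum φ F hg,
    evol_eq_sum φ F fun N h => by rw [map_add, hf N h, hg N h, add_zero],
    ← Finset.sum_add_distrib]
  simp only [map_add, mul_add]

theorem evol_mul (φ : A) (F : ℤ × ℤ → A) (f g : A) :
    evol φ F (f * g) = f * evol φ F g + g * evol φ F f := by
  classical
  have hf : ∀ N, N ∉ vars f ∪ vars g → twistedPd φ N f = 0 := fun N h =>
    twistedPd_eq_zero φ fun h' => h (Finset.mem_union_left _ h')
  have hg : ∀ N, N ∉ vars f ∪ vars g → twistedPd φ N g = 0 := fun N h =>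
    twistedPd_eq_zero φ fun h' => h (Finset.mem_union_right _ h')
  rw [evol_eq_sum φ F hf, evol_eq_sum φ F hg,
    evol_eq_sum φ F fun N h => by
      rw [Derivation.leibniz, hf N h, hg N h, smul_zero, smul_zero, add_zero],
    Finset.mul_sum, Finset.mul_sum, ← Finset.sum_add_distrib]
  refine Finset.sum_congr rfl fun N _ => ?_
  rw [Derivation.leibniz, smul_eq_mul, smul_eq_mul]
  ring

theorem evol_smul (φ : A) (F : ℤ × ℤ → A) (c : ℂ) (g : A) :
    evol φ F (c • g) = c • evol φ F g := by
  rw [evol_eq_sum_vars φ F g, evol_eq_sum φ F (T := vars g) fun N h => by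
      rw [Derivation.map_smul, twistedPd_eq_zero φ h, smul_zero], Finset.smul_sum]
  simp only [Derivation.map_smul, mul_smul_comm]

/-- The derivation `∑_N F_N S^N(φ) ∂/∂u_N`. -/
noncomputable def evolDerivation (φ : A) (F : ℤ × ℤ → A) : Derivation ℂ A A :=
  Derivation.mk' ⟨⟨evol φ F, evol_add φ F⟩, evol_smul φ F⟩ (evol_mul φ F)

theorem evol_zero (φ : A) (F : ℤ × ℤ → A) : evol φ F 0 = 0 :=
  map_zero (evolDerivation φ F)

theorem evol_sum (φ : A) (F : ℤ × ℤ → A) {ι : Type*} (T : Finset ι) (g : ι → A) :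
    evol φ F (∑ i ∈ T, g i) = ∑ i ∈ T, evol φ F (g i) :=
  map_sum (evolDerivation φ F) g T

theorem evol_coeff_add (φ : A) (F G : ℤ × ℤ → A) (g : A) :
    evol φ (fun N => F N + G N) g = evol φ F g + evol φ G g := by
  simp only [evol_eq_sum_vars, add_mul, Finset.sum_add_distrib]

theorem evol_coeff_mul (φ : A) (a : A) (F : ℤ × ℤ → A) (g : A) :
    evol φ (fun N => a * F N) g = a * evol φ F g := by
  simp only [evol_eq_sum_vars, mul_assoc, Finset.mul_sum]

theorem evol_coeff_smul (φ : A) (c : ℂ) (F : ℤ × ℤ → A) (g : A) :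
    evol φ (fun N => c • F N) g = c • evol φ F g := by
  simp only [evol_eq_sum_vars, smul_mul_assoc, Finset.smul_sum]

theorem evol_shift (φ : A) (F G : ℤ × ℤ → A) (I : ℤ × ℤ) (h : ∀ N, F (N + I) = shift I (G N))
    (g : A) : evol φ F (shift I g) = shift I (evol φ G g) := by
  have hT : ∀ N, N ∉ (vars g).map (addRightEmbedding I) → twistedPd φ N (shift I g) = 0 := by
    intro N hN
    rw [twistedPd_shift, twistedPd_eq_zero, map_zero]
    intro hN'
    exact hN (Finset.mem_map.2 ⟨N - I, hN', by simp⟩)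
  rw [evol_eq_sum φ F hT, evol_eq_sum_vars, map_sum, Finset.sum_map]
  refine Finset.sum_congr rfl fun N _ => ?_
  rw [addRightEmbedding_apply, twistedPd_shift, add_sub_cancel_right, h, map_mul]

/-! ### Evolutionary derivations with constant coefficients -/

/-- The value at `g` of the derivation `∑_N c_{J+N} S^N(φ) ∂/∂u_N`. -/
noncomputable def constEvol (φ : A) (c : ℤ × ℤ → ℂ) (J : ℤ × ℤ) : A → A :=
  evol φ fun N => algebraMap ℂ A (c (J + N))

theorem constEvol_shift (φ : A) (c : ℤ × ℤ → ℂ) (J I : ℤ × ℤ) (g : A) :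
    constEvol φ c J (shift I g) = shift I (constEvol φ c (J + I) g) :=
  evol_shift φ _ _ I (fun N => by rw [AlgEquiv.commutes, add_assoc, add_comm N]) g

theorem twistedPd_constEvol {φ : A} (hφ : IsFunctionOfU φ) (c : ℤ × ℤ → ℂ) (J N : ℤ × ℤ) (g : A) :
    twistedPd φ N (constEvol φ c J g) = constEvol φ c J (twistedPd φ N g) := by
  unfold constEvol
  -- `vars g` still suffices for D_N g: by commutation D_M kills it whenever D_M g = 0.
  rw [evol_eq_sum_vars, evol_eq_sum φ _ (T := vars g) fun M h => by
    rw [twistedPd_comm hφ, twistedPd_eq_zero φ h, map_zero], map_sum]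
  refine Finset.sum_congr rfl fun M _ => ?_
  rw [← Algebra.smul_def, ← Algebra.smul_def, Derivation.map_smul, twistedPd_comm hφ]

theorem constEvol_evol {φ : A} (hφ : IsFunctionOfU φ) (c : ℤ × ℤ → ℂ) (J : ℤ × ℤ)
    (F : ℤ × ℤ → A) (g : A) :
    constEvol φ c J (evol φ F g) =
      evol φ (fun N => constEvol φ c J (F N)) g + evol φ F (constEvol φ c J g) := by
  rw [evol_eq_sum_vars φ F g, evol_eq_sum_vars φ (fun N => constEvol φ c J (F N)) g,
    evol_eq_sum φ F (g := constEvol φ c J g) (T := vars g) fun M h => by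
      rw [twistedPd_constEvol hφ, twistedPd_eq_zero φ h]; exact evol_zero φ _,
    ← Finset.sum_add_distrib]
  refine (evol_sum φ _ _ _).trans (Finset.sum_congr rfl fun N _ => ?_)
  rw [evol_mul, twistedPd_constEvol hφ, add_comm, mul_comm (twistedPd φ N g)]
  rfl

/-- Both derivations have constant coefficients in the commuting frame D_N, and a derivation kills
constants. -/
theorem constEvol_comm {φ : A} (hφ : IsFunctionOfU φ) (c : ℤ × ℤ → ℂ) (J K : ℤ × ℤ) (g : A) :
    constEvol φ c J (constEvol φ c K g) = constEvol φ c K (constEvol φ c J g) := by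
  have h0 : (fun N => constEvol φ c J (algebraMap ℂ A (c (K + N)))) = fun _ => (0 : A) := by
    funext N
    exact (evolDerivation φ _).map_algebraMap _
  have h := constEvol_evol hφ c J (fun N => algebraMap ℂ A (c (K + N))) g
  rw [h0, evol_eq_sum_vars φ fun _ => (0 : A)] at h
  simpa [constEvol] using h

/-! ### The bracket of a conjugated constant coefficient operator -/

/-- The coefficient of `λ^I` in the `λ`-bracket of the operator `φ ∘ (∑_L c_L S^L) ∘ φ`. -/
noncomputable def conjBracket (φ : A) (c : ℤ × ℤ → ℂ) (f g : A) (I : ℤ × ℤ) : A :=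
  evol φ (fun N => shift I (constEvol φ c (I - N) f)) g

theorem conjBracket_eq_sum (φ : A) (c : ℤ × ℤ → ℂ) (f g : A) (I : ℤ × ℤ) :
    conjBracket φ c f g I = ∑ N ∈ vars g, ∑ M ∈ vars f,
      c (I + M - N) • (twistedPd φ N g * shift I (twistedPd φ M f)) := by
  unfold conjBracket constEvol
  rw [evol_eq_sum_vars]
  refine Finset.sum_congr rfl fun N _ => ?_
  rw [evol_eq_sum_vars, map_sum, Finset.sum_mul]
  refine Finset.sum_congr rfl fun M _ => ?_
  rw [← Algebra.smul_def, map_smul, smul_mul_assoc, mul_comm, sub_add_eq_add_sub]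

theorem conjBracket_skew (φ : A) {c : ℤ × ℤ → ℂ} (hc : ∀ L, c (-L) = -c L) (f g : A)
    (I : ℤ × ℤ) : conjBracket φ c g f I = -shift I (conjBracket φ c f g (-I)) := by
  rw [conjBracket_eq_sum, conjBracket_eq_sum, Finset.sum_comm, map_sum, ← Finset.sum_neg_distrib]
  refine Finset.sum_congr rfl fun N _ => ?_
  rw [map_sum, ← Finset.sum_neg_distrib]
  refine Finset.sum_congr rfl fun M _ => ?_
  rw [map_smul, map_mul, ← shift_add, add_neg_cancel, shift_zero, ← neg_smul, ← hc, mul_comm]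
  congr 2
  abel

theorem evol_conj_shift (φ : A) (c : ℤ × ℤ → ℂ) (f g : A) (K I : ℤ × ℤ) :
    evol φ (fun N => shift K (constEvol φ c (K - N) f)) (shift I g) =
      shift I (conjBracket φ c f g (K - I)) :=
  evol_shift φ _ _ I (fun N => by
    rw [← shift_add, add_sub_cancel, sub_sub, add_comm I]) g

theorem conjBracket_shift_right (φ : A) (c : ℤ × ℤ → ℂ) (f g : A) (K I : ℤ × ℤ) :
    conjBracket φ c f (shift I g) K = shift I (conjBracket φ c f g (K - I)) :=
  evol_conj_shift φ c f g K I

theorem conjBracket_shift_left (φ : A) (c : ℤ × ℤ → ℂ) (f g : A) (K I : ℤ × ℤ) :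
    conjBracket φ c (shift K f) g I = conjBracket φ c f g (I + K) := by
  unfold conjBracket
  congr 1
  funext N
  rw [constEvol_shift, ← shift_add, sub_add_eq_add_sub]

/-- A constant-coefficient evolutionary derivation acts on the bracket by the Leibniz rule. The term
differentiating f is flipped by skewsymmetry into the shape needed for Jacobi. -/
theorem constEvol_conjBracket {φ : A} (hφ : IsFunctionOfU φ) {c : ℤ × ℤ → ℂ}
    (hc : ∀ L, c (-L) = -c L) (f g : A) (J H : ℤ × ℤ) :
    constEvol φ c J (conjBracket φ c f g H) =
      conjBracket φ c f (constEvol φ c J g) H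
        - shift H (conjBracket φ c g (constEvol φ c (J + H) f) (-H)) := by
  rw [sub_eq_neg_add, ← conjBracket_skew φ hc]
  unfold conjBracket
  rw [constEvol_evol hφ]
  simp only [constEvol_shift, constEvol_comm hφ c (J + H)]

/-- Splits the nested bracket into first-order and second-order terms in h; the latter will cancel
in Jacobi. -/
theorem conjBracket_conjBracket {φ : A} (hφ : IsFunctionOfU φ) (c : ℤ × ℤ → ℂ) (f g h : A)
    (K I : ℤ × ℤ) :
    conjBracket φ c f (conjBracket φ c g h I) K =
      (∑ N ∈ vars h, shift I (conjBracket φ c f (constEvol φ c (I - N) g) (K - I)) *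
          twistedPd φ N h)
        + ∑ N ∈ vars h, ∑ M ∈ vars h, shift I (constEvol φ c (I - N) g) *
          (shift K (constEvol φ c (K - M) f) * twistedPd φ M (twistedPd φ N h)) := by
  rw [← Finset.sum_add_distrib]
  conv_lhs => rw [conjBracket, conjBracket, evol_eq_sum_vars φ _ h, evol_sum]
  refine Finset.sum_congr rfl fun N _ => ?_
  rw [evol_mul, evol_conj_shift, add_comm, mul_comm (twistedPd φ N h), ← Finset.mul_sum,
    evol_eq_sum φ _ (T := vars h) fun M hM => by
      rw [twistedPd_comm hφ, twistedPd_eq_zero φ hM, map_zero]]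

theorem conjBracket_jacobi {φ : A} (hφ : IsFunctionOfU φ) {c : ℤ × ℤ → ℂ}
    (hc : ∀ L, c (-L) = -c L) (f g h : A) (K I : ℤ × ℤ) :
    conjBracket φ c f (conjBracket φ c g h I) K - conjBracket φ c g (conjBracket φ c f h K) I =
      conjBracket φ c (conjBracket φ c f g (K - I)) h I := by
  -- The second-order terms are symmetric under exchanging (f, K) with (g, I), because the D_N
  -- commute.
  have hsymm : (∑ N ∈ vars h, ∑ M ∈ vars h, shift K (constEvol φ c (K - N) f) *
      (shift I (constEvol φ c (I - M) g) * twistedPd φ M (twistedPd φ N h))) =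
      ∑ N ∈ vars h, ∑ M ∈ vars h, shift I (constEvol φ c (I - N) g) *
        (shift K (constEvol φ c (K - M) f) * twistedPd φ M (twistedPd φ N h)) := by
    rw [Finset.sum_comm]
    refine Finset.sum_congr rfl fun N _ => Finset.sum_congr rfl fun M _ => ?_
    rw [twistedPd_comm hφ M N]
    ring
  rw [conjBracket_conjBracket hφ, conjBracket_conjBracket hφ, hsymm, add_sub_add_right_eq_sub,
    ← Finset.sum_sub_distrib]
  conv_rhs => rw [conjBracket, evol_eq_sum_vars]
  refine Finset.sum_congr rfl fun N _ => ?_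
  rw [constEvol_conjBracket hφ hc, map_sub, ← shift_add, add_sub_cancel, neg_sub, ← sub_mul,
    show I - N + (K - I) = K - N by abel]

/-! ### The master formula -/

theorem lambdaBracket_apply (P : (ℤ × ℤ) →₀ A) (f g : A) (I : ℤ × ℤ) :
    lambdaBracket P f g I = ∑ N ∈ vars g, ∑ M ∈ vars f,
      pd N g * shift N (P (I + M - N)) * shift I (pd M f) := by
  unfold lambdaBracket
  simp only [Finsupp.finsetSum_apply]
  refine Finset.sum_congr rfl fun N _ => Finset.sum_congr rfl fun M _ => ?_
  rw [Finsupp.sum_apply, Finsupp.sum, Finset.sum_eq_single (I + M - N)]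
  · rw [show N + (I + M - N) - M = I by abel, Finsupp.single_eq_same, map_mul, ← shift_add,
      show N + (I + M - N - M) = I by abel, mul_assoc]
  · intro L _ hL
    refine Finsupp.single_eq_of_ne fun h => hL ?_
    rw [h]; abel
  · intro h
    rw [Finsupp.notMem_support_iff.1 h]
    simp

theorem lambdaBracket_eq_conjBracket {P : (ℤ × ℤ) →₀ A} {φ : A} {c : ℤ × ℤ → ℂ}
    (hP : ∀ L, P L = c L • (φ * shift L φ)) (f g : A) (I : ℤ × ℤ) :
    lambdaBracket P f g I = conjBracket φ c f g I := by
  rw [lambdaBracket_apply, conjBracket_eq_sum]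
  refine Finset.sum_congr rfl fun N _ => Finset.sum_congr rfl fun M _ => ?_
  rw [hP, map_smul, map_mul, ← shift_add, add_sub_cancel, twistedPd_apply, twistedPd_apply,
    map_mul, ← shift_add, mul_smul_comm, smul_mul_assoc]
  congr 1
  ring

theorem isHamiltonian_of_conj {P : (ℤ × ℤ) →₀ A} {φ : A} (hφ : IsFunctionOfU φ) {c : ℤ × ℤ → ℂ}
    (hc : ∀ L, c (-L) = -c L) (hP : ∀ L, P L = c L • (φ * shift L φ)) : IsHamiltonian P where
  add_left f g h := by
    ext I
    simp only [Finsupp.add_apply, lambdaBracket_eq_conjBracket hP, conjBracket, constEvol,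
      evol_add, map_add, evol_coeff_add]
  add_right f g h := by
    ext I
    simp only [Finsupp.add_apply, lambdaBracket_eq_conjBracket hP, conjBracket, evol_add]
  smul_left a f g := by
    ext I
    simp only [Finsupp.smul_apply, lambdaBracket_eq_conjBracket hP, conjBracket, constEvol,
      evol_smul, map_smul, evol_coeff_smul]
  smul_right a f g := by
    ext I
    simp only [Finsupp.smul_apply, lambdaBracket_eq_conjBracket hP, conjBracket, evol_smul]
  sesqui_left₁ f g I := by
    simp only [lambdaBracket_eq_conjBracket hP, ← shift_fst, conjBracket_shift_left]
  sesqui_left₂ f g I := by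
    simp only [lambdaBracket_eq_conjBracket hP, ← shift_snd, conjBracket_shift_left]
  sesqui_right₁ f g I := by
    simp only [lambdaBracket_eq_conjBracket hP, ← shift_fst, conjBracket_shift_right]
  sesqui_right₂ f g I := by
    simp only [lambdaBracket_eq_conjBracket hP, ← shift_snd, conjBracket_shift_right]
  leibniz_right f g h I := by
    simp only [lambdaBracket_eq_conjBracket hP, conjBracket, evol_mul]
    ring
  leibniz_left f g h I := by
    simp only [lambdaBracket_eq_conjBracket hP, conjBracket, constEvol, evol_mul, map_add, map_mul,
      evol_coeff_add, evol_coeff_mul]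
    ring
  skew f g I := by
    simp only [lambdaBracket_eq_conjBracket hP, conjBracket_skew φ hc f g I]
  jacobi f g h K I := by
    simp only [lambdaBracket_eq_conjBracket hP, conjBracket_jacobi hφ hc]

/-! ### Coefficients of the operator of general form -/

/-- The coefficients of the constant coefficient operator `constantOp`. -/
noncomputable def constCoeff (α β γ δ ε : ℂ) : (ℤ × ℤ) →₀ ℂ :=
  (Finsupp.single (2, 0) α + Finsupp.single (1, 1) β + Finsupp.single (0, 2) γ
    + Finsupp.single (1, 0) δ + Finsupp.single (0, 1) ε)
  - (Finsupp.single (-2, 0) α + Finsupp.single (-1, -1) β + Finsupp.single (0, -2) γ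
    + Finsupp.single (-1, 0) δ + Finsupp.single (0, -1) ε)

theorem constCoeff_neg (α β γ δ ε : ℂ) (L : ℤ × ℤ) :
    constCoeff α β γ δ ε (-L) = -constCoeff α β γ δ ε L := by
  have h : ∀ (K : ℤ × ℤ) (a : ℂ), Finsupp.single K a (-L) = Finsupp.single (-K) a L := by
    intro K a
    simp only [Finsupp.single_apply, neg_eq_iff_eq_neg]
  simp only [constCoeff, Finsupp.sub_apply, Finsupp.add_apply, h, Prod.neg_mk, neg_neg, neg_zero]
  ring

theorem constantOp_apply {A : Type*} [CommRing A] [Algebra ℂ A] (α β γ δ ε : ℂ) (L : ℤ × ℤ) :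
    (constantOp α β γ δ ε : (ℤ × ℤ) →₀ A) L = algebraMap ℂ A (constCoeff α β γ δ ε L) := by
  have h : ∀ (K : ℤ × ℤ) (a : ℂ), Finsupp.single K (algebraMap ℂ A a) L =
      algebraMap ℂ A (Finsupp.single K a L) := by
    intro K a
    simp only [Finsupp.single_apply, apply_ite (algebraMap ℂ A), map_zero]
  simp only [constCoeff, constantOp, monomialOp, Finsupp.sub_apply, Finsupp.add_apply, h, map_sub,
    map_add]

theorem compOp_monomialOp_zero_apply (P : (ℤ × ℤ) →₀ A) (a : A) (L : ℤ × ℤ) :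
    compOp P (monomialOp 0 a) L = P L * shift L a := by
  unfold compOp monomialOp
  simp only [map_zero, mul_zero, Finsupp.single_zero, Finsupp.sum_single_index, add_zero]
  rw [Finsupp.sum_apply, Finsupp.sum, Finset.sum_eq_single L]
  · rw [Finsupp.single_eq_same]
  · intro K _ hK
    exact Finsupp.single_eq_of_ne hK.symm
  · intro h
    rw [Finsupp.notMem_support_iff.1 h]
    simp

theorem monomialOp_zero_compOp_apply (P : (ℤ × ℤ) →₀ A) (a : A) (L : ℤ × ℤ) :
    compOp (monomialOp 0 a) P L = a * P L := by
  unfold compOp monomialOp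
  rw [Finsupp.sum_single_index (by simp)]
  simp only [zero_add, shift_zero]
  rw [Finsupp.sum_apply, Finsupp.sum, Finset.sum_eq_single L]
  · rw [Finsupp.single_eq_same]
  · intro K _ hK
    exact Finsupp.single_eq_of_ne hK.symm
  · intro h
    rw [Finsupp.notMem_support_iff.1 h]
    simp

theorem generalOp_apply (f : A) (α β γ δ ε : ℂ) (L : ℤ × ℤ) :
    generalOp f α β γ δ ε L = constCoeff α β γ δ ε L • (f * shift L f) := by
  rw [generalOp, monomialOp_zero_compOp_apply, compOp_monomialOp_zero_apply, constantOp_apply,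
    Algebra.smul_def]
  ring

/-! ### The Jacobi identity on the generator -/

theorem lambdaBracket_u_left (P : (ℤ × ℤ) →₀ A) (g : A) (I : ℤ × ℤ) {T : Finset (ℤ × ℤ)}
    (hT : ∀ N, N ∉ T → pd N g = 0) :
    lambdaBracket P (u 0) g I = ∑ N ∈ T, pd N g * shift N (P (I - N)) := by
  classical
  have hu : ∀ N ∈ vars g, ∑ M ∈ vars (u 0 : A),
      pd N g * shift N (P (I + M - N)) * shift I (pd M (u 0 : A)) =
      pd N g * shift N (P (I - N)) := by
    intro N _
    rw [Finset.sum_eq_single 0]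
    · rw [pd_u, if_pos rfl, map_one, mul_one, add_zero]
    · intro M _ hM
      rw [pd_u, if_neg hM, map_zero, mul_zero]
    · intro h
      rw [pd_eq_zero_of_notMem_vars h, map_zero, mul_zero]
  rw [lambdaBracket_apply, Finset.sum_congr rfl hu]
  rw [Finset.sum_subset (Finset.subset_union_left (s₂ := T)), eq_comm,
    Finset.sum_subset (Finset.subset_union_right (s₁ := vars g))]
  · intro N _ h
    rw [hT N h, zero_mul]
  · intro N _ h
    rw [pd_eq_zero_of_notMem_vars h, zero_mul]

theorem lambdaBracket_u_u (P : (ℤ × ℤ) →₀ A) : lambdaBracket P (u 0) (u 0) = P := by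
  ext I
  rw [lambdaBracket_u_left P (u 0) I (T := {0}) fun N h => by
    rw [pd_u, if_neg (by simpa using h)], Finset.sum_singleton, pd_u, if_pos rfl, shift_zero,
    one_mul, sub_zero]

/-- The Jacobi identity on the generator `u`, at a coefficient whose right-hand side vanishes. -/
theorem IsHamiltonian.pd_mul_eq {P : (ℤ × ℤ) →₀ A} (hP : IsHamiltonian P) {K I : ℤ × ℤ}
    (hK : K ≠ 0) (hI : I ≠ 0) (h₁ : P (K - I) = 0) (h₂ : P (I - K) = 0)
    (hvK : ∀ N, N ∉ ({0, K} : Finset (ℤ × ℤ)) → pd N (P K) = 0)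
    (hvI : ∀ N, N ∉ ({0, I} : Finset (ℤ × ℤ)) → pd N (P I) = 0) :
    pd 0 (P I) * P K = pd 0 (P K) * P I := by
  have h := hP.jacobi (u 0) (u 0) (u 0) K I
  -- Only N = 0 survives in each nested bracket: the terms at N = I and N = K carry P_{K-I} and
  -- P_{I-K}.
  rw [lambdaBracket_u_u, h₁, lambdaBracket_u_left P _ _ hvK, lambdaBracket_u_left P _ _ hvI,
    Finset.sum_pair hK.symm, Finset.sum_pair hI.symm, h₁, h₂, lambdaBracket_apply] at h
  simp only [map_zero, mul_zero, add_zero, shift_zero, sub_zero, Finset.sum_const_zero] at h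
  exact sub_eq_zero.1 h

/-- An odd family has symmetric support and vanishes at 0, so its largest exponent is positive.
Positivity makes the sum of two such exponents exceed both. -/
theorem exists_lex_max {c : (ℤ × ℤ) →₀ ℂ} (hc : c ≠ 0) (hn : ∀ L, c (-L) = -c L) :
    ∃ a, c a ≠ 0 ∧ 0 < toLex a ∧ ∀ L, toLex a < toLex L → c L = 0 := by
  obtain ⟨a, ha, hmax⟩ := c.support.exists_max_image toLex (Finsupp.support_nonempty_iff.2 hc)
  have ha' : c a ≠ 0 := Finsupp.mem_support_iff.1 ha
  refine ⟨a, ha', ?_, fun L hL => ?_⟩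
  · have h1 : toLex (-a) ≤ toLex a := hmax _ (Finsupp.mem_support_iff.2 (by rwa [hn, neg_ne_zero]))
    rw [toLex_neg, neg_le_self_iff] at h1
    refine lt_of_le_of_ne h1 fun h0 => ha' ?_
    have h2 : a = 0 := h0.symm
    have h3 := hn 0
    rw [neg_zero, self_eq_neg] at h3
    rw [h2, h3]
  · by_contra h
    exact (hmax L (Finsupp.mem_support_iff.2 h)).not_gt hL

/-! ### Vanishing of the Wronskian -/

section Domain

variable [IsDomain A]

theorem wronskian_eq_zero {P : (ℤ × ℤ) →₀ A} (hP : IsHamiltonian P) {f g : A}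
    (hf : IsFunctionOfU f) (hg : IsFunctionOfU g) (hf0 : f ≠ 0) (hg0 : g ≠ 0)
    {c d : (ℤ × ℤ) →₀ ℂ} (hc : c ≠ 0) (hd : d ≠ 0) (hcn : ∀ L, c (-L) = -c L)
    (hdn : ∀ L, d (-L) = -d L)
    (hL : ∀ L, P L = c L • (f * shift L f) + d L • (g * shift L g)) :
    f * pd 0 g = g * pd 0 f := by
  have hpd : ∀ L N, pd N (P L) = c L • (f * pd N (shift L f) + shift L f * pd N f)
      + d L • (g * pd N (shift L g) + shift L g * pd N g) := by
    intro L N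
    rw [hL, map_add, Derivation.map_smul, Derivation.map_smul, Derivation.leibniz, Derivation.leibniz]
    simp only [smul_eq_mul]
  have hv : ∀ L N, N ∉ ({0, L} : Finset (ℤ × ℤ)) → pd N (P L) = 0 := by
    intro L N hN
    simp only [Finset.mem_insert, Finset.mem_singleton, not_or] at hN
    rw [hpd, hf.pd_shift_of_ne hN.2, hg.pd_shift_of_ne hN.2, hf N hN.1, hg N hN.1]
    simp
  have hpd0 : ∀ L, L ≠ 0 → pd 0 (P L) = c L • (shift L f * pd 0 f)
      + d L • (shift L g * pd 0 g) := by
    intro L h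
    rw [hpd, hf.pd_shift_of_ne h.symm, hg.pd_shift_of_ne h.symm]
    simp
  obtain ⟨a, hca, ha0, hamax⟩ := exists_lex_max hc hcn
  obtain ⟨b, hdb, hb0, hbmax⟩ := exists_lex_max hd hdn
  have ha : a ≠ 0 := fun h => ha0.ne (by rw [h]; rfl)
  have hb : b ≠ 0 := fun h => hb0.ne (by rw [h]; rfl)
  have hcz : c (b + a) = 0 := hamax _ (by rw [toLex_add]; exact lt_add_of_pos_left _ hb0)
  have hdz : d (b + a) = 0 := hbmax _ (by rw [toLex_add]; exact lt_add_of_pos_right _ ha0)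
  have hz₁ : P (b - -a) = 0 := by rw [hL, sub_neg_eq_add, hcz, hdz]; simp
  have hz₂ : P (-a - b) = 0 := by
    rw [hL, show -a - b = -(b + a) by abel, hcn, hdn, hcz, hdz]; simp
  -- K = b and I = -a have opposite signs, so K - I = a + b lies beyond both supports.
  have key := hP.pd_mul_eq hb (neg_ne_zero.2 ha) hz₁ hz₂ (hv _) (hv _)
  rw [hpd0 _ hb, hpd0 _ (neg_ne_zero.2 ha), hL, hL, hcn, hdn] at key
  simp only [Algebra.smul_def, map_neg] at key
  have hinj : ∀ z : ℂ, z ≠ 0 → algebraMap ℂ A z ≠ 0 := fun z hz =>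
    (map_ne_zero_iff _ (algebraMap ℂ A).injective).2 hz
  have hs : ∀ (N : ℤ × ℤ) (x : A), x ≠ 0 → shift N x ≠ 0 := fun N x hx =>
    (map_ne_zero_iff _ (shift N : A ≃ₐ[ℂ] A).injective).2 hx
  have key' : (f * pd 0 g - g * pd 0 f) *
      (algebraMap ℂ A (c a) * algebraMap ℂ A (d b) * (shift (-a) f * shift b g)
        - algebraMap ℂ A (c b) * algebraMap ℂ A (d a) * (shift (-a) g * shift b f)) = 0 := by
    linear_combination key
  rcases mul_eq_zero.1 key' with h | h
  · exact sub_eq_zero.1 h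
  -- The second factor is zero. For a = b, apply ∂_a to the resulting identity: it sees only the
  -- factors shifted by a, and combining both identities gives S^a of the Wronskian relation.
  rcases eq_or_ne a b with rfl | hab
  · have h1 : shift (-a) f * shift a g = shift (-a) g * shift a f := by
      apply mul_left_cancel₀ (mul_ne_zero (hinj _ hca) (hinj _ hdb))
      linear_combination h
    have hne : a ≠ -a := by
      intro h'
      have h2 : toLex a = -toLex a := h'
      exact ha0.ne' (self_eq_neg.1 h2)
    have h2 := congrArg (pd a) h1
    simp only [Derivation.leibniz, smul_eq_mul, hf.pd_shift_of_ne hne, hg.pd_shift_of_ne hne,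
      pd_shift_self, mul_zero, add_zero] at h2
    apply (shift a : A ≃ₐ[ℂ] A).injective
    rw [map_mul, map_mul]
    apply mul_left_cancel₀ (hs (-a) f hf0)
    linear_combination shift a f * h2 - shift a (pd 0 f) * h1
  -- For a ≠ b, maximality of the smaller exponent kills c_b or d_a. The remaining product is
  -- nonzero in a domain, a contradiction.
  · have h0 : algebraMap ℂ A (c b) * algebraMap ℂ A (d a) = 0 := by
      rcases lt_or_gt_of_ne (fun h => hab (toLex.injective h) : toLex a ≠ toLex b) with h' | h'
      · rw [hamax b h', map_zero, zero_mul]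
      · rw [hbmax a h', map_zero, mul_zero]
    rw [h0, zero_mul, sub_zero] at h
    exact absurd h (mul_ne_zero (mul_ne_zero (hinj _ hca) (hinj _ hdb))
      (mul_ne_zero (hs _ f hf0) (hs _ g hg0)))

end Domain

theorem generalOp_ne_zero {f : A} {α β γ δ ε : ℂ} (h : generalOp f α β γ δ ε ≠ 0) :
    f ≠ 0 ∧ constCoeff α β γ δ ε ≠ 0 := by
  constructor
  · rintro rfl
    exact h (Finsupp.ext fun L => by rw [generalOp_apply, zero_mul, smul_zero]; rfl)
  · intro h0
    exact h (Finsupp.ext fun L => by rw [generalOp_apply, h0, Finsupp.zero_apply, zero_smul]; rfl)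

end DifferenceFunctionAlgebra

/-! ### The two directions of the equivalence -/

open DifferenceFunctionAlgebra in
theorem isBiHamiltonianPair_generalOp_smul {A : Type*} [CommRing A] [Algebra ℂ A]
    [DifferenceFunctionAlgebra A] {f : A} (hf : IsFunctionOfU f) (κ : ℂ)
    (α₁ β₁ γ₁ δ₁ ε₁ α₂ β₂ γ₂ δ₂ ε₂ : ℂ) :
    IsBiHamiltonianPair (generalOp f α₁ β₁ γ₁ δ₁ ε₁) (generalOp (κ • f) α₂ β₂ γ₂ δ₂ ε₂) := by
  have h : ∀ η : ℂ, IsHamiltonian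
      (generalOp f α₁ β₁ γ₁ δ₁ ε₁ + η • generalOp (κ • f) α₂ β₂ γ₂ δ₂ ε₂) := fun η =>
    isHamiltonian_of_conj hf
      (c := fun L => constCoeff α₁ β₁ γ₁ δ₁ ε₁ L + η * (κ * κ) * constCoeff α₂ β₂ γ₂ δ₂ ε₂ L)
      (fun L => by simp only [constCoeff_neg]; ring)
      fun L => by
        rw [Finsupp.add_apply, Finsupp.smul_apply, generalOp_apply, generalOp_apply]
        simp only [Algebra.smul_def, map_add, map_mul, AlgEquiv.commutes]
        ring
  refine ⟨by simpa using h 0, ?_, h⟩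
  refine isHamiltonian_of_conj (fun N hN => ?_) (constCoeff_neg α₂ β₂ γ₂ δ₂ ε₂)
    (generalOp_apply (κ • f) α₂ β₂ γ₂ δ₂ ε₂)
  rw [Derivation.map_smul, hf N hN, smul_zero]

theorem mainTheorem5 {A : Type*} [CommRing A] [IsDomain A] [Algebra ℂ A]
    [DifferenceFunctionAlgebra A]
    (hA : DifferenceFunctionAlgebra.OnlyComplexConstants A)
    (f₁ f₂ : A)
    (hf₁ : DifferenceFunctionAlgebra.IsFunctionOfU f₁)
    (hf₂ : DifferenceFunctionAlgebra.IsFunctionOfU f₂)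
    (α₁ β₁ γ₁ δ₁ ε₁ α₂ β₂ γ₂ δ₂ ε₂ : ℂ)
    (hP : DifferenceFunctionAlgebra.generalOp f₁ α₁ β₁ γ₁ δ₁ ε₁ ≠ 0)
    (hQ : DifferenceFunctionAlgebra.generalOp f₂ α₂ β₂ γ₂ δ₂ ε₂ ≠ 0) :
    DifferenceFunctionAlgebra.IsBiHamiltonianPair
        (DifferenceFunctionAlgebra.generalOp f₁ α₁ β₁ γ₁ δ₁ ε₁)
        (DifferenceFunctionAlgebra.generalOp f₂ α₂ β₂ γ₂ δ₂ ε₂) ↔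
      ∃ κ : ℂ, κ ≠ 0 ∧ f₂ = κ • f₁ := by
  constructor
  · rintro ⟨-, -, h⟩
    -- The single value η = 1 suffices.
    have hR := h 1
    obtain ⟨hf, hc⟩ := DifferenceFunctionAlgebra.generalOp_ne_zero hP
    obtain ⟨hg, hd⟩ := DifferenceFunctionAlgebra.generalOp_ne_zero hQ
    have hW : ∀ N, f₁ * DifferenceFunctionAlgebra.pd N f₂ =
        f₂ * DifferenceFunctionAlgebra.pd N f₁ := by
      intro N
      rcases eq_or_ne N 0 with rfl | hN
      · exact DifferenceFunctionAlgebra.wronskian_eq_zero hR hf₁ hf₂ hf hg hc hd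
          (DifferenceFunctionAlgebra.constCoeff_neg _ _ _ _ _)
          (DifferenceFunctionAlgebra.constCoeff_neg _ _ _ _ _) fun L => by
            rw [one_smul, Finsupp.add_apply, DifferenceFunctionAlgebra.generalOp_apply,
              DifferenceFunctionAlgebra.generalOp_apply]
      · rw [hf₁ N hN, hf₂ N hN, mul_zero, mul_zero]
    obtain ⟨κ, hκ⟩ := hA f₂ f₁ hf hW
    refine ⟨κ, ?_, hκ⟩
    rintro rfl
    exact hg (by rw [hκ, zero_smul])
  · rintro ⟨κ, -, rfl⟩
    exact isBiHamiltonianPair_generalOp_smul hf₁ κ _ _ _ _ _ _ _ _ _ _
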